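/- **Theorem (soundness for confluence).** Let $\mathcal{F}$ be a signature and $\mathcal{V}$ a countably infinite set of variables. A conditional term rewrite system (CTRS) $\mathcal{R}$ over $\mathcal{F}$ is a set of rules $\alpha : l \to r \Leftarrow s_1 \to^* t_1, \ldots, s_k \to^* t_k$ ($k \ge 0$) with terms $l, r, s_i, t_i$ over $\mathcal F$ and $\mathcal V$. Its rewrite relation is $\to_{\mathcal{R}} \,=\, \bigcup_n \to_{\mathcal{R}_n}$, where $\mathcal{R}_0 = \emptyset$ and $\mathcal{R}_{n+1}$ is the set of all $l\sigma \to r\sigma$ such that $\sigma$ is a substitution, $(l \to r \Leftarrow s_1 \to^* t_1, \ldots, s_k \to^* t_k) \in \mathcal{R}$ and $s_i\sigma \to^*_{\mathcal{R}_n} t_i\sigma$ for all $i$. Suppose that * $\mathcal{R}$ is *deterministic*: for each rule, $\mathrm{Var}(r) \subseteq \mathrm{Var}(l, s_1, t_1, \ldots, s_k, t_k)$, and $\mathrm{Var}(s_i) \subseteq \mathrm{Var}(l, t_1, \ldots, t_{i-1})$ for all $i \in \{1, \ldots, k\}$; * $\mathcal{R}$ is *right-stable*: for each rule and all $i \in \{1,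 \ldots, k\}$, the term $t_i$ is either a linear constructor term (no variable occurs in it twice, and no symbol in it is the root symbol of a left-hand side $l$ of a rule of $\mathcal{R}$) or a ground term that is irreducible with respect to the unconditional rules $\{\, l \to r \mid (l \to r \Leftarrow c) \in \mathcal{R} \,\}$; and $\mathrm{Var}(t_i) \cap \mathrm{Var}(l, s_1, t_1, \ldots, s_{i-1}, t_{i-1}, s_i) = \emptyset$. The *sequential unraveling* $\mathbb{U}_{seq}(\mathcal{R})$ is the unconditional term rewrite system, over $\mathcal{F}$ extended by pairwise distinct new function symbols $U^\alpha_i$ ($\alpha \in \mathcal{R}$ a rule with $k \ge 1$ conditions, $1 \le i \le k$), that contains every unconditional rule $l \to r$ of $\mathcal{R}$ and, for every rule $\alpha \in \mathcal R$ with $k \ge 1$ conditions, the rules $$l \to U^\alpha_1(s_1, \vec{X_1}), \qquad U^\alpha_i(t_i, \vec{X_i}) \to U^\alpha_{i+1}(s_{i+1}, \vec{X_{i+1}}) \ \ (1 \le i < k), \qquad U^\alpha_k(t_k, \vec{X_k}) \to r,$$ where $\vec{X_i}$ lists the variables in $X_i = \mathrm{Var}(l, t_1, \ldots, t_{i-1})$,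 each once, in an arbitrary but fixed order. If $\mathbb{U}_{seq}(\mathcal{R})$ is confluent and terminating (on all terms over the extended signature), then $\mathcal{R}$ is confluent, i.e. whenever $u \to^*_{\mathcal{R}} v$ and $u \to^*_{\mathcal{R}} w$ there is a term $z$ with $v \to^*_{\mathcal{R}} z$ and $w \to^*_{\mathcal{R}} z$. No soundness of the unraveling is assumed: it is not required that $u \to^*_{\mathbb{U}_{seq}(\mathcal{R})} v$ implies $u \to^*_{\mathcal{R}} v$ for terms $u, v$ over $\mathcal{F}$. -/

import Mathlib

/-!
Terms over a signature are Mathlib's first-order terms `L.Term V`: the function symbols of arity `n`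
are the elements of `L.Functions n` and the variables are the elements of `V`. (The relation symbols
of `L` play no role.) Substitution is `FirstOrder.Language.Term.subst`, the set of variables of a
term is `FirstOrder.Language.Term.varFinset`.
-/

namespace Rewriting

open FirstOrder FirstOrder.Language

universe u v w

/-! ### Abstract properties of a rewrite relation -/

/-- `r` is confluent: any two terms reachable from a common term have a common reduct. -/
def Confluent {A : Type*} (r : A → A → Prop) : Prop :=
  ∀ a b c : A, Relation.ReflTransGen r a b → Relation.ReflTransGen r a c →
    ∃ d : A, Relation.ReflTransGen r b d ∧ Relation.ReflTransGen r c d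

/-- `r` is terminating: there is no infinite sequence `a₀ r a₁ r a₂ r ⋯`. -/
def Terminating {A : Type*} (r : A → A → Prop) : Prop :=
  WellFounded (fun a b : A => r b a)

/-- `a` is irreducible (a normal form) with respect to `r`. -/
def IsNormalForm {A : Type*} (r : A → A → Prop) (a : A) : Prop :=
  ∀ b : A, ¬ r a b

/-! ### Unconditional rewriting -/

section Unconditional

variable {L : FirstOrder.Language.{u, v}} {V : Type w}

/-- One rewrite step with the rules `S` (pairs of a left-hand side and a right-hand side): an
instance `l σ` of a left-hand side, at some position, is replaced by `r σ`. -/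
inductive Step (S : Set (L.Term V × L.Term V)) : L.Term V → L.Term V → Prop
  | root {l r : L.Term V} (h : (l, r) ∈ S) (σ : V → L.Term V) : Step S (l.subst σ) (r.subst σ)
  | arg {n : ℕ} (f : L.Functions n) (ts : Fin n → L.Term V) (i : Fin n) (t : L.Term V)
      (h : Step S (ts i) t) : Step S (Term.func f ts) (Term.func f (Function.update ts i t))

/-- The rewrite relation `→*` of the rules `S`. -/
def Steps (S : Set (L.Term V × L.Term V)) : L.Term V → L.Term V → Prop :=
  Relation.ReflTransGen (Step S)

/-- The number of occurrences of the variable `x` in a term. -/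
def occurrences [DecidableEq V] (x : V) : L.Term V → ℕ
  | .var y => if y = x then 1 else 0
  | .func _ ts => ∑ i, occurrences x (ts i)

/-- A term is linear if no variable occurs in it more than once. -/
def IsLinear [DecidableEq V] (t : L.Term V) : Prop :=
  ∀ x : V, occurrences x t ≤ 1

/-- A term is ground if it contains no variable. -/
def IsGround [DecidableEq V] (t : L.Term V) : Prop :=
  t.varFinset = ∅

end Unconditional

/-! ### Conditional rewriting -/

/-- A conditional rule `l → r ⇐ s₁ →* t₁, …, sₖ →* tₖ`; the list of conditions is
`[(s₁, t₁), …, (sₖ, tₖ)]`, and it is empty for an unconditional rule. -/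
structure CRule (L : FirstOrder.Language.{u, v}) (V : Type w) where
  lhs : L.Term V
  rhs : L.Term V
  conds : List (L.Term V × L.Term V)

/-- An (oriented) conditional term rewrite system over the signature `L`. -/
abbrev CTRS (L : FirstOrder.Language.{u, v}) (V : Type w) := Set (CRule L V)

namespace CRule

variable {L : FirstOrder.Language.{u, v}} {V : Type w}

/-- The number `k` of conditions. -/
abbrev length (α : CRule L V) : ℕ := α.conds.length

/-- The left-hand side `sᵢ` of the `i`-th condition, counted from `0`. -/
def src (α : CRule L V) (i : Fin α.length) : L.Term V := (α.conds.get i).1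

/-- The right-hand side `tᵢ` of the `i`-th condition, counted from `0`. -/
def tgt (α : CRule L V) (i : Fin α.length) : L.Term V := (α.conds.get i).2

variable [DecidableEq V]

/-- The variables of `l` and of all `tⱼ` with `j` before `i`. -/
def boundVars (α : CRule L V) (i : Fin α.length) : Finset V :=
  α.lhs.varFinset ∪ (Finset.univ.filter (· < i)).biUnion fun j => (α.tgt j).varFinset

/-- The variables of `l`, of all `sⱼ`, `tⱼ` with `j` before `i`, and of `sᵢ`. -/
def precedingVars (α : CRule L V) (i : Fin α.length) : Finset V :=
  α.lhs.varFinset ∪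
    ((Finset.univ.filter (· < i)).biUnion fun j => (α.src j).varFinset ∪ (α.tgt j).varFinset) ∪
    (α.src i).varFinset

/-- The variables of the conditions. -/
def condVars (α : CRule L V) : Finset V :=
  Finset.univ.biUnion fun j => (α.src j).varFinset ∪ (α.tgt j).varFinset

/-- A rule is of type 3 if each variable of the right-hand side occurs in the left-hand side or in
the conditions. -/
def IsType3 (α : CRule L V) : Prop :=
  α.rhs.varFinset ⊆ α.condVars ∪ α.lhs.varFinset

/-- A deterministic rule: of type 3, and each variable of `sᵢ` occurs in `l` or in an earlier
`tⱼ`. -/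
def IsDeterministic (α : CRule L V) : Prop :=
  α.IsType3 ∧ ∀ i : Fin α.length, (α.src i).varFinset ⊆ α.boundVars i

end CRule

namespace CTRS

variable {L : FirstOrder.Language.{u, v}} {V : Type w}

/-- The rules `R₀ = ∅` and `Rₙ₊₁ = {l σ → r σ | l → r ⇐ c ∈ R, s σ →* t σ in Rₙ for all
s →* t in c}`. -/
def level (R : CTRS L V) : ℕ → Set (L.Term V × L.Term V)
  | 0 => ∅
  | n + 1 => {p | ∃ α ∈ R, ∃ σ : V → L.Term V,
      p = (α.lhs.subst σ, α.rhs.subst σ) ∧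
      ∀ c ∈ α.conds, Steps (R.level n) (c.1.subst σ) (c.2.subst σ)}

/-- The rewrite relation of a conditional term rewrite system. -/
def Rewrites (R : CTRS L V) (s t : L.Term V) : Prop :=
  ∃ n : ℕ, Step (R.level n) s t

/-- The underlying unconditional system `R_u`. -/
def underlying (R : CTRS L V) : Set (L.Term V × L.Term V) :=
  {p | ∃ α ∈ R, p = (α.lhs, α.rhs)}

/-- A function symbol is defined if it is the root symbol of the left-hand side of a rule. -/
def IsDefined (R : CTRS L V) {n : ℕ} (f : L.Functions n) : Prop :=
  ∃ α ∈ R, ∃ ts : Fin n → L.Term V, α.lhs = Term.func f ts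

/-- A constructor term contains no defined function symbol. -/
def IsConstructorTerm (R : CTRS L V) : L.Term V → Prop
  | .var _ => True
  | .func f ts => ¬ R.IsDefined f ∧ ∀ i, R.IsConstructorTerm (ts i)

variable [DecidableEq V]

/-- A deterministic conditional term rewrite system (DCTRS). -/
def IsDeterministic (R : CTRS L V) : Prop :=
  ∀ α ∈ R, α.IsDeterministic

/-- Right-stability: each `tᵢ` is a linear constructor term or a ground term that is irreducible
with respect to `R_u`, and it shares no variable with `l, s₁, t₁, …, sᵢ₋₁, tᵢ₋₁, sᵢ`. -/
def IsRightStable (R : CTRS L V) : Prop :=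
  ∀ α ∈ R, ∀ i : Fin α.length,
    ((IsLinear (α.tgt i) ∧ R.IsConstructorTerm (α.tgt i)) ∨
      (IsGround (α.tgt i) ∧ IsNormalForm (Step R.underlying) (α.tgt i))) ∧
    Disjoint (α.tgt i).varFinset (α.precedingVars i)

end CTRS

/-! ### The sequential unraveling -/

/-- A fixed order on each finite set of variables: the sequence `e.seq X` lists the elements of `X`,
each exactly once. -/
structure VarSeq (V : Type w) where
  seq : Finset V → List V
  nodup : ∀ X : Finset V, (seq X).Nodup
  mem_seq : ∀ (X : Finset V) (x : V), x ∈ seq X ↔ x ∈ X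

section Unraveling

variable {L : FirstOrder.Language.{u, v}} {V : Type w} [DecidableEq V]

/-- The U-symbols: one new symbol `U^α_i` for each rule `α` of `R` and each condition `i` of `α`.
Its arity is one more than the number of variables in `X_i = Var(l, t₁, …, tᵢ₋₁)`. -/
inductive USymbol (R : CTRS L V) (e : VarSeq V) : ℕ → Type (max u w)
  | U (α : CRule L V) (hα : α ∈ R) (i : Fin α.length) :
      USymbol R e ((e.seq (α.boundVars i)).length + 1)

/-- The signature consisting of the U-symbols. -/
def USymbols (R : CTRS L V) (e : VarSeq V) : FirstOrder.Language.{max u w, 0} where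
  Functions := USymbol R e
  Relations := fun _ => Empty

/-- The signature of the unraveled system: the original symbols and the U-symbols. -/
abbrev USig (R : CTRS L V) (e : VarSeq V) : FirstOrder.Language := L.sum (USymbols R e)

/-- An original term, viewed as a term over the signature of the unraveled system. -/
abbrev orig (R : CTRS L V) (e : VarSeq V) (t : L.Term V) : (USig R e).Term V :=
  (LHom.sumInl : L →ᴸ L.sum (USymbols R e)).onTerm t

/-- The term `U^α_i(s, x₁, …, xₘ)` where `x₁, …, xₘ` is the sequence of the variables in `X_i`. -/
def uTerm (R : CTRS L V) (e : VarSeq V) (α : CRule L V) (hα : α ∈ R) (i : Fin α.length)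
    (s : (USig R e).Term V) : (USig R e).Term V :=
  Term.func (L := USig R e) (l := (e.seq (α.boundVars i)).length + 1)
    (Sum.inr (USymbol.U α hα i))
    (Fin.cons s fun j => Term.var ((e.seq (α.boundVars i)).get j))

/-- The rules `lhs → rhs` of the sequential unraveling of `R`. -/
inductive USeqRule (R : CTRS L V) (e : VarSeq V) :
    (USig R e).Term V → (USig R e).Term V → Prop
  /-- An unconditional rule is kept. -/
  | unconditional (α : CRule L V) (hα : α ∈ R) (h : α.length = 0) :
      USeqRule R e (orig R e α.lhs) (orig R e α.rhs)
  /-- `l → U^α_1(s₁, X₁)` -/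
  | introduction (α : CRule L V) (hα : α ∈ R) (h : 0 < α.length) :
      USeqRule R e (orig R e α.lhs) (uTerm R e α hα ⟨0, h⟩ (orig R e (α.src ⟨0, h⟩)))
  /-- `U^α_i(tᵢ, Xᵢ) → U^α_{i+1}(sᵢ₊₁, Xᵢ₊₁)` -/
  | switch (α : CRule L V) (hα : α ∈ R) (i : ℕ) (h : i + 1 < α.length) :
      USeqRule R e
        (uTerm R e α hα ⟨i, Nat.lt_of_succ_lt h⟩ (orig R e (α.tgt ⟨i, Nat.lt_of_succ_lt h⟩)))
        (uTerm R e α hα ⟨i + 1, h⟩ (orig R e (α.src ⟨i + 1, h⟩)))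
  /-- `U^α_k(tₖ, Xₖ) → r` -/
  | elimination (α : CRule L V) (hα : α ∈ R) (i : Fin α.length) (h : (i : ℕ) + 1 = α.length) :
      USeqRule R e (uTerm R e α hα i (orig R e (α.tgt i))) (orig R e α.rhs)

/-- The sequential unraveling, an unconditional term rewrite system over `USig R e`. -/
def USeq (R : CTRS L V) (e : VarSeq V) : Set ((USig R e).Term V × (USig R e).Term V) :=
  {p | USeqRule R e p.1 p.2}

end Unraveling

end Rewriting

namespace Rewriting

open FirstOrder FirstOrder.Language

universe u v w

/-! ### Rewriting in contexts and normal forms -/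

section Unconditional

variable {L : FirstOrder.Language.{u, v}} {V : Type w}

/-! Write →_U for rewriting in the unraveling. Conditional derivations are simulated by it
(`steps_orig`). In the converse direction only innermost normalization has to be sound, up to a
backtranslation `backtrans` that turns a stuck term U^α_i(s, X_i σ) back into lσ: every original
term v has a U-normal form n with v →*_R `backtrans n`. If v and w are R-reducts of u, their
U-normal forms coincide by confluence, and the backtranslation of that normal form joins v and w.

The core is `soundNormalization_orig_subst`, stated for instances tσ of original terms with
normalized σ, so that U-symbols occur only inside σ. Well-founded induction along reducts and
immediate subterms normalizes the arguments first; a root redex lτ then has normalized τ. In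
U^α_i(s_i τ, X_i τ) the first argument is normalized by induction. Either the term is now stuck and
backtranslates to an instance of l, or it matches t_i, which certifies the i-th condition and binds
the variables of t_i. After the last condition, the passage from l to r backtranslates to a genuine
conditional step. -/

theorem Step.mono {S T : Set (L.Term V × L.Term V)} (h : S ⊆ T) {s t : L.Term V}
    (hst : Step S s t) : Step T s t := by
  induction hst with
  | root hlr σ => exact .root (h hlr) σ
  | arg f ts i t _ ih => exact .arg f ts i t ih

theorem Steps.mono {S T : Set (L.Term V × L.Term V)} (h : S ⊆ T) {s t : L.Term V}
    (hst : Steps S s t) : Steps T s t :=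
  Relation.ReflTransGen.mono (fun _ _ => Step.mono h) _ _ hst

theorem Steps.update {S : Set (L.Term V × L.Term V)} {n : ℕ} (f : L.Functions n)
    (ts : Fin n → L.Term V) (i : Fin n) {t : L.Term V} (h : Steps S (ts i) t) :
    Steps S (Term.func f ts) (Term.func f (Function.update ts i t)) := by
  induction h with
  | refl => rw [Function.update_eq_self]; exact .refl
  | tail _ hst ih =>
    refine ih.tail ?_
    have := Step.arg (S := S) f (Function.update ts i _) i _
      (by rw [Function.update_self]; exact hst)
    rwa [Function.update_idem] at this

theorem Steps.func {S : Set (L.Term V × L.Term V)} {n : ℕ} (f : L.Functions n)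
    {ts us : Fin n → L.Term V} (h : ∀ i, Steps S (ts i) (us i)) :
    Steps S (Term.func f ts) (Term.func f us) := by
  -- The arguments are rewritten one index at a time; `s` is the set of indices already done.
  suffices H : ∀ s : Finset (Fin n),
      Steps S (Term.func f ts) (Term.func f (s.piecewise us ts)) by
    simpa using H Finset.univ
  intro s
  induction s using Finset.induction_on with
  | empty => rw [Finset.piecewise_empty]; exact .refl
  | insert i s hi ih =>
    rw [Finset.piecewise_insert]
    refine Relation.ReflTransGen.trans ih (Steps.update f _ i ?_)
    rw [Finset.piecewise_eq_of_notMem _ _ _ hi]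
    exact h i

theorem IsNormalForm.of_func {S : Set (L.Term V × L.Term V)} {n : ℕ} {f : L.Functions n}
    {ts : Fin n → L.Term V} (h : IsNormalForm (Step S) (Term.func f ts)) (i : Fin n) :
    IsNormalForm (Step S) (ts i) :=
  fun t ht => h _ (.arg f ts i t ht)

theorem IsNormalForm.of_subst [DecidableEq V] {S : Set (L.Term V × L.Term V)} {t : L.Term V}
    {σ : V → L.Term V} (h : IsNormalForm (Step S) (t.subst σ)) {x : V} (hx : x ∈ t.varFinset) :
    IsNormalForm (Step S) (σ x) := by
  induction t with
  | var y =>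
    obtain rfl : x = y := by simpa [Term.varFinset] using hx
    exact h
  | func f ts ih =>
    obtain ⟨i, hi⟩ : ∃ i, x ∈ (ts i).varFinset := by simpa [Term.varFinset] using hx
    exact ih i (IsNormalForm.of_func (f := f) h i) hi

theorem IsNormalForm.eq_of_steps {S : Set (L.Term V × L.Term V)} {s t : L.Term V}
    (h : IsNormalForm (Step S) s) (hst : Steps S s t) : s = t := by
  induction hst with
  | refl => rfl
  | tail _ hst ih => subst ih; exact absurd hst (h _)

/-- The innermost principle: above normalized arguments, only the root can be a redex. -/
theorem Step.func_cases {S : Set (L.Term V × L.Term V)} {n : ℕ} {f : L.Functions n}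
    {ts : Fin n → L.Term V} (hts : ∀ i, IsNormalForm (Step S) (ts i)) {b : L.Term V}
    (h : Step S (Term.func f ts) b) :
    ∃ l r, (l, r) ∈ S ∧ ∃ σ : V → L.Term V, Term.func f ts = l.subst σ ∧ b = r.subst σ := by
  generalize ha : Term.func f ts = a at h
  cases h with
  | root h σ => exact ⟨_, _, h, σ, rfl, rfl⟩
  | arg g us i t h =>
    cases ha
    exact absurd h (hts i _)

/-! ### Substitutions -/

theorem subst_congr [DecidableEq V] {t : L.Term V} {σ τ : V → L.Term V}
    (h : ∀ x ∈ t.varFinset, σ x = τ x) : t.subst σ = t.subst τ := by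
  induction t with
  | var y => exact h y (by simp [Term.varFinset])
  | func f ts ih =>
    simp only [Term.subst]
    congr 1
    funext i
    exact ih i fun x hx => h x (by simpa [Term.varFinset] using ⟨i, hx⟩)

theorem subst_subst (t : L.Term V) (σ τ : V → L.Term V) :
    (t.subst σ).subst τ = t.subst fun x => (σ x).subst τ := by
  induction t with
  | var y => rfl
  | func f ts ih => simp only [Term.subst, ih]

theorem Step.subst {S : Set (L.Term V × L.Term V)} {s t : L.Term V} (h : Step S s t)
    (τ : V → L.Term V) : Step S (s.subst τ) (t.subst τ) := by
  induction h with
  | root h σ => rw [subst_subst, subst_subst]; exact .root h _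
  | arg f ts i t _ ih =>
    have := Step.arg (S := S) f (fun j => (ts j).subst τ) i _ ih
    simp only [Term.subst]
    convert this using 2
    funext j
    by_cases hj : j = i
    · subst hj; simp
    · simp [hj]

theorem Steps.subst {S : Set (L.Term V × L.Term V)} {s t : L.Term V} (h : Steps S s t)
    (τ : V → L.Term V) : Steps S (s.subst τ) (t.subst τ) :=
  Relation.ReflTransGen.lift (fun s : L.Term V => s.subst τ) (fun _ _ h => Step.subst h τ) _ _ h

theorem subst_var (t : L.Term V) : t.subst Term.var = t := by
  induction t with
  | var y => rfl
  | func f ts ih => simp only [Term.subst, ih]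

/-- `s` is a reduct or an immediate subterm of `t`. -/
def Below (S : Set (L.Term V × L.Term V)) (s t : L.Term V) : Prop :=
  Step S t s ∨ ∃ (n : ℕ) (f : L.Functions n) (ts : Fin n → L.Term V) (i : Fin n),
    t = Term.func f ts ∧ s = ts i

/-- Reflexive-transitive closure of the immediate subterm relation. -/
inductive Subterm : L.Term V → L.Term V → Prop
  | refl (t : L.Term V) : Subterm t t
  | arg {n : ℕ} (f : L.Functions n) (ts : Fin n → L.Term V) (i : Fin n) {t : L.Term V}
      (h : Subterm (Term.func f ts) t) : Subterm (ts i) t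

theorem Subterm.exists_step {S : Set (L.Term V × L.Term V)} {s t : L.Term V} (h : Subterm s t) :
    ∀ {s' : L.Term V}, Step S s s' → ∃ t', Step S t t' ∧ Subterm s' t' := by
  induction h with
  | refl t => exact fun hs => ⟨_, hs, .refl _⟩
  | @arg n f ts i t _ ih =>
    intro s' hs
    obtain ⟨t', ht, hsub⟩ := ih (.arg f ts i s' hs)
    have := Subterm.arg f _ i hsub
    rw [Function.update_self] at this
    exact ⟨t', ht, this⟩

/-- A step in a subterm lifts to the surrounding term and keeps the reduct as a subterm. So the
outer induction follows the rewriting of a host term `u`, and the inner one the structure of its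
subterm `s`. -/
theorem Below.wellFounded {S : Set (L.Term V × L.Term V)} (hS : Terminating (Step S)) :
    WellFounded (Below S) := by
  suffices H : ∀ u s, Subterm s u → Acc (Below S) s from ⟨fun u => H u u (.refl u)⟩
  intro u
  induction u using hS.induction with
  | _ u ihu =>
  intro s
  induction s with
  | var x =>
    refine fun hs => ⟨_, ?_⟩
    rintro s' (h | ⟨n, f, ts, i, h, -⟩)
    · obtain ⟨u', hu, hs'⟩ := hs.exists_step h
      exact ihu u' hu s' hs'
    · cases h
  | func f ts ih =>
    refine fun hs => ⟨_, ?_⟩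
    rintro s' (h | ⟨n, g, us, i, h, rfl⟩)
    · obtain ⟨u', hu, hs'⟩ := hs.exists_step h
      exact ihu u' hu s' hs'
    · cases h
      exact ih i (.arg f ts i hs)

theorem Steps.below {S : Set (L.Term V × L.Term V)} {s t : L.Term V} (h : Steps S s t) :
    Relation.ReflTransGen (Below S) t s := by
  induction h with
  | refl => exact .refl
  | tail _ h ih => exact .head (.inl h) ih

/-- A rule with a variable as left-hand side would apply to every term, even to an irreducible one.
-/
theorem Terminating.lhs_ne_var {S : Set (L.Term V × L.Term V)} (hS : Terminating (Step S))
    {l r : L.Term V} (h : (l, r) ∈ S) (x : V) : l ≠ Term.var x := by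
  rintro rfl
  obtain ⟨m, -, hm⟩ := hS.has_min Set.univ ⟨Term.var x, trivial⟩
  exact hm _ trivial (Step.root h fun _ => m)

end Unconditional

/-! ### The rewrite relation of a conditional system -/

namespace CTRS

variable {L : FirstOrder.Language.{u, v}} {V : Type w} (R : CTRS L V)

theorem level_mono : Monotone R.level := by
  refine monotone_nat_of_le_succ fun n => ?_
  induction n with
  | zero => exact Set.empty_subset _
  | succ n ih =>
    rintro p ⟨α, hα, σ, hp, hc⟩
    exact ⟨α, hα, σ, hp, fun c hcα => (hc c hcα).mono ih⟩

/-- Makes the general facts about `Step` and `Steps`, notably closure under contexts, available for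
`R.Rewrites`. -/
theorem rewrites_eq : R.Rewrites = Step (⋃ n, R.level n) := by
  ext s t
  refine ⟨fun ⟨n, h⟩ => h.mono (Set.subset_iUnion _ n), fun h => ?_⟩
  induction h with
  | root h σ =>
    obtain ⟨n, hn⟩ := Set.mem_iUnion.1 h
    exact ⟨n, .root hn σ⟩
  | arg f ts i t _ ih =>
    obtain ⟨n, hn⟩ := ih
    exact ⟨n, .arg f ts i t hn⟩

variable {R}

theorem exists_level_of_rewrites {s t : L.Term V} (h : Relation.ReflTransGen R.Rewrites s t) :
    ∃ n, Steps (R.level n) s t := by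
  induction h with
  | refl => exact ⟨0, .refl⟩
  | tail _ h ih =>
    obtain ⟨n, hn⟩ := ih
    obtain ⟨m, hm⟩ := h
    exact ⟨max n m, (hn.mono (R.level_mono (le_max_left n m))).tail
      (hm.mono (R.level_mono (le_max_right n m)))⟩

theorem rewrites_subst {α : CRule L V} (hα : α ∈ R) {σ : V → L.Term V}
    (h : ∀ i : Fin α.length,
      Relation.ReflTransGen R.Rewrites ((α.src i).subst σ) ((α.tgt i).subst σ)) :
    R.Rewrites (α.lhs.subst σ) (α.rhs.subst σ) := by
  choose n hn using fun i => exists_level_of_rewrites (h i)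
  -- The finitely many conditions all hold at the supremum of their levels, so the rule instance
  -- appears one level higher.
  refine ⟨Finset.univ.sup n + 1, ?_⟩
  have := Step.root (S := R.level (Finset.univ.sup n + 1)) (l := α.lhs.subst σ)
    (r := α.rhs.subst σ) ⟨α, hα, σ, rfl, fun c hc => ?_⟩ Term.var
  · rwa [subst_var, subst_var] at this
  · obtain ⟨i, rfl⟩ := List.mem_iff_get.1 hc
    exact (hn i).mono (R.level_mono (Finset.le_sup (Finset.mem_univ i)))

end CTRS

/-! ### Instances of the rules of the sequential unraveling -/

section Unraveling

variable {L : FirstOrder.Language.{u, v}} {V : Type w} [DecidableEq V]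
  {R : CTRS L V} {e : VarSeq V}

theorem orig_func {n : ℕ} (f : L.Functions n) (ts : Fin n → L.Term V) :
    orig R e (Term.func f ts) =
      Term.func (L := USig R e) (Sum.inl f) fun i => orig R e (ts i) := rfl

theorem varFinset_orig (t : L.Term V) : (orig R e t).varFinset = t.varFinset := by
  induction t with
  | var x => rfl
  | func f ts ih =>
    rw [orig_func]
    simp only [Term.varFinset, ih]

theorem orig_subst (t : L.Term V) (σ : V → L.Term V) :
    orig R e (t.subst σ) = (orig R e t).subst fun x => orig R e (σ x) := by
  induction t with
  | var x => rfl
  | func f ts ih =>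
    simp only [Term.subst, orig_func, ih]

/-- The term `U^α_i(s, x₁ σ, …, xₘ σ)`. -/
def uApp (R : CTRS L V) (e : VarSeq V) (α : CRule L V) (hα : α ∈ R) (i : Fin α.length)
    (s : (USig R e).Term V) (σ : V → (USig R e).Term V) : (USig R e).Term V :=
  Term.func (L := USig R e) (l := (e.seq (α.boundVars i)).length + 1)
    (Sum.inr (USymbol.U α hα i))
    (Fin.cons s fun j => σ ((e.seq (α.boundVars i)).get j))

theorem uTerm_subst {α : CRule L V} (hα : α ∈ R) (i : Fin α.length)
    (s : (USig R e).Term V) (σ : V → (USig R e).Term V) :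
    (uTerm R e α hα i s).subst σ = uApp R e α hα i (s.subst σ) σ := by
  simp only [uTerm, uApp, Term.subst]
  congr 1
  funext j
  refine Fin.cases ?_ (fun j => ?_) j <;> simp [Term.subst]

theorem uApp_congr {α : CRule L V} (hα : α ∈ R) (i : Fin α.length)
    (s : (USig R e).Term V) {σ τ : V → (USig R e).Term V}
    (h : ∀ x ∈ α.boundVars i, σ x = τ x) : uApp R e α hα i s σ = uApp R e α hα i s τ := by
  unfold uApp
  congr 2
  funext j
  exact h _ ((e.mem_seq _ _).1 (List.get_mem _ _))

/-- The rule and the number of a condition of a U-symbol at the root of a term. -/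
def uRoot (R : CTRS L V) (e : VarSeq V) : (USig R e).Term V → Option (Σ α : CRule L V, Fin α.length)
  | .var _ => none
  | .func (Sum.inl _) _ => none
  | .func (Sum.inr (USymbol.U α _ i)) _ => some ⟨α, i⟩

theorem uRoot_uApp {α : CRule L V} (hα : α ∈ R) (i : Fin α.length)
    (s : (USig R e).Term V) (σ : V → (USig R e).Term V) :
    uRoot R e (uApp R e α hα i s σ) = some ⟨α, i⟩ := rfl

theorem uRoot_orig_subst {t : L.Term V} (ht : ∀ x, t ≠ Term.var x)
    (σ : V → (USig R e).Term V) : uRoot R e ((orig R e t).subst σ) = none := by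
  cases t with
  | var x => exact absurd rfl (ht x)
  | func f ts => rfl

theorem uApp_inj {α : CRule L V} {hα : α ∈ R} {i : Fin α.length}
    {s t : (USig R e).Term V} {σ τ : V → (USig R e).Term V}
    (h : uApp R e α hα i s σ = uApp R e α hα i t τ) :
    s = t ∧ ∀ x ∈ α.boundVars i, σ x = τ x := by
  have h' := (Term.func.inj h).2.2
  have h' := eq_of_heq h'
  refine ⟨by simpa using congrFun h' 0, fun x hx => ?_⟩
  obtain ⟨j, rfl⟩ := List.mem_iff_get.1 ((e.mem_seq _ _).2 hx)
  simpa using congrFun h' j.succ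

theorem steps_uApp {α : CRule L V} (hα : α ∈ R) (i : Fin α.length)
    {s t : (USig R e).Term V} (σ : V → (USig R e).Term V) (h : Steps (USeq R e) s t) :
    Steps (USeq R e) (uApp R e α hα i s σ) (uApp R e α hα i t σ) := by
  refine Steps.func _ fun j => ?_
  refine Fin.cases ?_ (fun j => ?_) j
  · simpa using h
  · exact .refl

theorem step_unconditional {α : CRule L V} (hα : α ∈ R) (h : α.length = 0)
    (σ : V → (USig R e).Term V) :
    Step (USeq R e) ((orig R e α.lhs).subst σ) ((orig R e α.rhs).subst σ) :=
  .root (S := USeq R e) (.unconditional α hα h) σ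

theorem step_introduction {α : CRule L V} (hα : α ∈ R) (h : 0 < α.length)
    (σ : V → (USig R e).Term V) :
    Step (USeq R e) ((orig R e α.lhs).subst σ)
      (uApp R e α hα ⟨0, h⟩ ((orig R e (α.src ⟨0, h⟩)).subst σ) σ) := by
  rw [← uTerm_subst]
  exact .root (S := USeq R e) (.introduction α hα h) σ

theorem step_switch {α : CRule L V} (hα : α ∈ R) (i : ℕ) (h : i + 1 < α.length)
    (σ : V → (USig R e).Term V) :
    Step (USeq R e)
      (uApp R e α hα ⟨i, Nat.lt_of_succ_lt h⟩
        ((orig R e (α.tgt ⟨i, Nat.lt_of_succ_lt h⟩)).subst σ) σ)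
      (uApp R e α hα ⟨i + 1, h⟩ ((orig R e (α.src ⟨i + 1, h⟩)).subst σ) σ) := by
  rw [← uTerm_subst, ← uTerm_subst]
  exact .root (S := USeq R e) (.switch α hα i h) σ

theorem step_elimination {α : CRule L V} (hα : α ∈ R) (i : Fin α.length)
    (h : (i : ℕ) + 1 = α.length) (σ : V → (USig R e).Term V) :
    Step (USeq R e) (uApp R e α hα i ((orig R e (α.tgt i)).subst σ) σ)
      ((orig R e α.rhs).subst σ) := by
  rw [← uTerm_subst]
  exact .root (S := USeq R e) (.elimination α hα i h) σ

/-! ### Completeness: conditional steps are simulated by the unraveling -/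

/-- The U-symbols are traversed in order: below U^α_i the first argument is rewritten from s_i to
t_i, which enables the next rule. -/
theorem steps_orig_lhs {α : CRule L V} (hα : α ∈ R) {σ : V → (USig R e).Term V}
    (h : ∀ i : Fin α.length, Steps (USeq R e) ((orig R e (α.src i)).subst σ)
      ((orig R e (α.tgt i)).subst σ)) :
    Steps (USeq R e) ((orig R e α.lhs).subst σ) ((orig R e α.rhs).subst σ) := by
  rcases Nat.eq_zero_or_pos α.length with h0 | h0
  · exact .single (step_unconditional hα h0 σ)
  have key : ∀ (i : ℕ) (hi : i < α.length), Steps (USeq R e) ((orig R e α.lhs).subst σ)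
      (uApp R e α hα ⟨i, hi⟩ ((orig R e (α.tgt ⟨i, hi⟩)).subst σ) σ) := by
    intro i
    induction i with
    | zero => exact fun hi => .head (step_introduction hα hi σ) (steps_uApp hα _ σ (h _))
    | succ i ih =>
      exact fun hi => ((ih (Nat.lt_of_succ_lt hi)).tail (step_switch hα i hi σ)).trans
        (steps_uApp hα _ σ (h _))
  exact (key (α.length - 1) (by omega)).tail
    (step_elimination hα ⟨α.length - 1, by omega⟩ (by simp only; omega) σ)

theorem steps_orig_of_level (n : ℕ) {s t : L.Term V} (h : Steps (R.level n) s t) :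
    Steps (USeq R e) (orig R e s) (orig R e t) := by
  induction n generalizing s t with
  | zero =>
    have H : ∀ {s t : L.Term V}, ¬ Step (R.level 0) s t := by
      intro s t h
      induction h with
      | root h σ => exact h
      | arg f ts i t _ ih => exact ih
    cases IsNormalForm.eq_of_steps (fun _ => H) h
    exact .refl
  | succ n ihn =>
    have H : ∀ {s t : L.Term V}, Step (R.level (n + 1)) s t →
        Steps (USeq R e) (orig R e s) (orig R e t) := by
      intro s t h
      induction h with
      | root h σ =>
        obtain ⟨α, hα, τ, hp, hc⟩ := h
        obtain ⟨rfl, rfl⟩ := Prod.mk.inj hp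
        have := steps_orig_lhs (e := e) hα (σ := fun x => orig R e (τ x)) fun i => by
          rw [← orig_subst, ← orig_subst]
          exact ihn (hc _ (List.get_mem _ i))
        rw [← orig_subst, ← orig_subst] at this
        -- Rules of a level are already instances, by `τ`; the step instantiates them once more, by
        -- `σ`.
        rw [orig_subst (α.lhs.subst τ), orig_subst (α.rhs.subst τ)]
        exact this.subst _
      | arg f ts i t _ ih =>
        rw [orig_func, orig_func]
        refine Steps.func _ fun j => ?_
        by_cases hj : j = i
        · subst hj; rw [Function.update_self]; exact ih
        · rw [Function.update_of_ne hj]; exact .refl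
    induction h with
    | refl => exact .refl
    | tail _ h ih => exact Relation.ReflTransGen.trans ih (H h)

theorem steps_orig {s t : L.Term V} (h : Relation.ReflTransGen R.Rewrites s t) :
    Steps (USeq R e) (orig R e s) (orig R e t) :=
  let ⟨n, hn⟩ := CTRS.exists_level_of_rewrites h
  steps_orig_of_level n hn

/-! ### The backtranslation -/

/-- The term over the original signature that a term of the unraveled system stands for: a term
`U^α_i(s, x₁ σ, …, xₘ σ)` is replaced by the instance of the left-hand side of `α`. -/
def backtrans (R : CTRS L V) (e : VarSeq V) : (USig R e).Term V → L.Term V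
  | .var x => .var x
  | .func (Sum.inl f) ts => .func f fun i => backtrans R e (ts i)
  | .func (Sum.inr (USymbol.U α _ i)) ts =>
      α.lhs.subst fun x =>
        -- `Fin.succ` skips argument 0, which holds the condition under evaluation and is forgotten.
        -- Since Var(l) ⊆ X_i, the default value is never used on variables of l.
        if h : x ∈ e.seq (α.boundVars i) then
          backtrans R e (ts (Fin.succ ⟨(e.seq (α.boundVars i)).idxOf x, List.idxOf_lt_length_iff.2 h⟩))
        else .var x

theorem backtrans_orig_subst (t : L.Term V) (σ : V → (USig R e).Term V) :
    backtrans R e ((orig R e t).subst σ) = t.subst fun x => backtrans R e (σ x) := by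
  induction t with
  | var x => rfl
  | func f ts ih =>
    simp only [orig_func, Term.subst, backtrans, ih]

/-- The result depends neither on `i` nor on `s`, so passing from one condition to the next costs no
conditional step. -/
theorem backtrans_uApp {α : CRule L V} (hα : α ∈ R) (i : Fin α.length)
    (s : (USig R e).Term V) (σ : V → (USig R e).Term V) :
    backtrans R e (uApp R e α hα i s σ) = α.lhs.subst fun x => backtrans R e (σ x) := by
  simp only [uApp, backtrans]
  refine subst_congr fun x hx => ?_
  have hx' : x ∈ e.seq (α.boundVars i) :=
    (e.mem_seq _ _).2 (Finset.mem_union_left _ hx)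
  rw [dif_pos hx', Fin.cons_succ]
  simp

/-! ### Innermost normalization in the unraveling is sound -/

/-- `s` has a normal form whose backtranslation is reachable from `t`. -/
def SoundNormalization (R : CTRS L V) (e : VarSeq V) (s : (USig R e).Term V) (t : L.Term V) :
    Prop :=
  ∃ n, Steps (USeq R e) s n ∧ IsNormalForm (Step (USeq R e)) n ∧
    Relation.ReflTransGen R.Rewrites t (backtrans R e n)

theorem SoundNormalization.of_steps {s s' : (USig R e).Term V} {t t' : L.Term V}
    (h : SoundNormalization R e s' t') (hs : Steps (USeq R e) s s')
    (ht : Relation.ReflTransGen R.Rewrites t t') : SoundNormalization R e s t :=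
  let ⟨n, hn, hnf, hr⟩ := h
  ⟨n, hs.trans hn, hnf, ht.trans hr⟩

/-- All instances of original terms by normalized substitutions below `u` have sound
normalizations. -/
def SoundBelow (R : CTRS L V) (e : VarSeq V) (u : (USig R e).Term V) : Prop :=
  ∀ (t : L.Term V) (σ : V → (USig R e).Term V), (∀ x, IsNormalForm (Step (USeq R e)) (σ x)) →
    Relation.TransGen (Below (USeq R e)) ((orig R e t).subst σ) u →
    SoundNormalization R e ((orig R e t).subst σ) (t.subst fun x => backtrans R e (σ x))

theorem SoundBelow.of_steps {u u' : (USig R e).Term V} (h : SoundBelow R e u)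
    (hu : Steps (USeq R e) u u') : SoundBelow R e u' :=
  fun t σ hσ ht => h t σ hσ (ht.trans_left hu.below)

/-! ### Matching against left-hand sides of the unraveling -/

theorem lhs_ne_var (hterm : Terminating (Step (USeq R e))) {α : CRule L V} (hα : α ∈ R) (x : V) :
    α.lhs ≠ Term.var x := by
  intro h
  rcases Nat.eq_zero_or_pos α.length with h0 | h0
  · exact hterm.lhs_ne_var (.unconditional α hα h0) x (by rw [h]; rfl)
  · exact hterm.lhs_ne_var (.introduction α hα h0) x (by rw [h]; rfl)

theorem boundVars_mono (α : CRule L V) {i j : Fin α.length} (h : i ≤ j) :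
    α.boundVars i ⊆ α.boundVars j := by
  refine Finset.union_subset_union_right (Finset.biUnion_subset_biUnion_of_subset_left _ ?_)
  intro k hk
  simp only [Finset.mem_filter, Finset.mem_univ, true_and] at hk ⊢
  exact hk.trans_le h

theorem tgt_varFinset_subset (α : CRule L V) {i j : Fin α.length} (h : i < j) :
    (α.tgt i).varFinset ⊆ α.boundVars j := by
  intro x hx
  refine Finset.mem_union_right _ (Finset.mem_biUnion.2 ⟨i, ?_, hx⟩)
  simpa using h

/-- The root U^α_i determines α and i, and every rule with this root on the left has the left-hand
side U^α_i(t_i, X_i). -/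
theorem match_uApp (hterm : Terminating (Step (USeq R e))) {α : CRule L V} {hα : α ∈ R}
    {i : Fin α.length} {n l r : (USig R e).Term V} {σ ρ : V → (USig R e).Term V}
    (hlr : (l, r) ∈ USeq R e) (h : uApp R e α hα i n σ = l.subst ρ) :
    n = (orig R e (α.tgt i)).subst ρ ∧ ∀ x ∈ α.boundVars i, σ x = ρ x := by
  have key : ∀ {β : CRule L V} {hβ : β ∈ R} {j : Fin β.length},
      uApp R e α hα i n σ = (uTerm R e β hβ j (orig R e (β.tgt j))).subst ρ →
      n = (orig R e (α.tgt i)).subst ρ ∧ ∀ x ∈ α.boundVars i, σ x = ρ x := by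
    intro β hβ j h
    rw [uTerm_subst] at h
    have hroot := congrArg (uRoot R e) h
    rw [uRoot_uApp, uRoot_uApp] at hroot
    cases hroot
    exact uApp_inj h
  have no : ∀ {β : CRule L V} (hβ : β ∈ R), uApp R e α hα i n σ ≠ (orig R e β.lhs).subst ρ := by
    intro β hβ h
    have hroot := congrArg (uRoot R e) h
    rw [uRoot_uApp, uRoot_orig_subst (lhs_ne_var hterm hβ)] at hroot
    cases hroot
  rcases hlr with ⟨β, hβ, _⟩ | ⟨β, hβ, _⟩ | ⟨β, hβ, j, _⟩ | ⟨β, hβ, j, _⟩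
  · exact absurd h (no hβ)
  · exact absurd h (no hβ)
  · exact key h
  · exact key h

theorem isNormalForm_var (hterm : Terminating (Step (USeq R e))) (x : V) :
    IsNormalForm (Step (USeq R e)) (Term.var x) := by
  intro b hb
  generalize ha : (Term.var x : (USig R e).Term V) = a at hb
  cases hb with
  | @root l r h σ =>
    cases l with
    | var y => exact hterm.lhs_ne_var h y rfl
    | func f ts => cases ha
  | arg => cases ha

/-- A substitution can be made trivial outside of the variables on which it is normalized. -/
theorem exists_normalized (hterm : Terminating (Step (USeq R e))) (X : Finset V)
    (ρ : V → (USig R e).Term V) (hρ : ∀ x ∈ X, IsNormalForm (Step (USeq R e)) (ρ x)) :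
    ∃ τ : V → (USig R e).Term V, (∀ x, IsNormalForm (Step (USeq R e)) (τ x)) ∧
      ∀ x ∈ X, τ x = ρ x := by
  refine ⟨fun x => if x ∈ X then ρ x else Term.var x, fun x => ?_, fun x hx => if_pos hx⟩
  by_cases hx : x ∈ X
  · simpa only [if_pos hx] using hρ x hx
  · simpa only [if_neg hx] using isNormalForm_var hterm x

/-- The conditions before `i` hold for the backtranslation of `σ`. -/
def CondsHold (R : CTRS L V) (e : VarSeq V) (α : CRule L V) (i : ℕ)
    (σ : V → (USig R e).Term V) : Prop :=
  ∀ j : Fin α.length, (j : ℕ) < i → Relation.ReflTransGen R.Rewrites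
    ((α.src j).subst fun x => backtrans R e (σ x)) ((α.tgt j).subst fun x => backtrans R e (σ x))

/-- Innermost normalization of `U^α_i(sᵢ, Xᵢ) σ` either stops below the root, or the next rule
for `U^α_i` applies and the `i`-th condition holds as well. -/
theorem soundNormalization_or_match (hterm : Terminating (Step (USeq R e)))
    (hdet : R.IsDeterministic) {α : CRule L V} (hα : α ∈ R) (i : Fin α.length)
    (σ : V → (USig R e).Term V) (hσ : ∀ x, IsNormalForm (Step (USeq R e)) (σ x))
    (hc : CondsHold R e α i σ)
    (ih : SoundBelow R e (uApp R e α hα i ((orig R e (α.src i)).subst σ) σ)) :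
    SoundNormalization R e (uApp R e α hα i ((orig R e (α.src i)).subst σ) σ)
      (α.lhs.subst fun x => backtrans R e (σ x)) ∨
    ∃ τ : V → (USig R e).Term V, (∀ x, IsNormalForm (Step (USeq R e)) (τ x)) ∧
      (∀ x ∈ α.boundVars i, τ x = σ x) ∧ CondsHold R e α (i + 1) τ ∧
      Steps (USeq R e) (uApp R e α hα i ((orig R e (α.src i)).subst σ) σ)
        (uApp R e α hα i ((orig R e (α.tgt i)).subst τ) τ) := by
  -- s_i σ is argument 0, hence an immediate subterm.
  obtain ⟨n, hn, hnf, hr⟩ := ih (α.src i) σ hσ (.single (.inr ⟨_, _, _, 0, rfl, rfl⟩))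
  have hsteps := steps_uApp hα i σ hn
  by_cases hw : IsNormalForm (Step (USeq R e)) (uApp R e α hα i n σ)
  · exact .inl ⟨_, hsteps, hw, by rw [backtrans_uApp]⟩
  right
  unfold IsNormalForm at hw
  push Not at hw
  obtain ⟨b, hb⟩ := hw
  obtain ⟨l, r, hlr, ρ, hl, -⟩ := Step.func_cases (fun j => by
    refine Fin.cases ?_ (fun j => ?_) j
    · exact hnf
    · exact hσ _) hb
  obtain ⟨rfl, hσρ⟩ := match_uApp hterm hlr hl
  -- The match controls `ρ` only on X_i and Var(t_i), while the induction needs a substitution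
  -- normalized everywhere.
  obtain ⟨τ, hτ, hτρ⟩ := exists_normalized hterm (α.boundVars i ∪ (α.tgt i).varFinset) ρ (by
    intro x hx
    rcases Finset.mem_union.1 hx with hx | hx
    · rw [← hσρ x hx]; exact hσ x
    · exact hnf.of_subst (by rwa [varFinset_orig]))
  have hτσ : ∀ x ∈ α.boundVars i, τ x = σ x := fun x hx => by
    rw [hσρ x hx, hτρ x (Finset.mem_union_left _ hx)]
  have ht : (orig R e (α.tgt i)).subst ρ = (orig R e (α.tgt i)).subst τ :=
    subst_congr fun x hx => (hτρ x (Finset.mem_union_right _ (by rwa [varFinset_orig] at hx))).symm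
  -- Values bound earlier do not change, and by determinism the earlier conditions and s_i use only
  -- such values, so what is known for `σ` transfers to `τ`.
  have hs : ∀ {t : L.Term V}, t.varFinset ⊆ α.boundVars i →
      (t.subst fun x => backtrans R e (τ x)) = t.subst fun x => backtrans R e (σ x) :=
    fun h => subst_congr fun x hx => by rw [hτσ x (h hx)]
  refine ⟨τ, hτ, hτσ, fun j hj => ?_, ?_⟩
  · rcases Nat.lt_succ_iff_lt_or_eq.1 hj with hj | hj
    · rw [hs (((hdet α hα).2 j).trans (boundVars_mono α (Fin.le_of_lt hj))),
        hs (tgt_varFinset_subset α hj)]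
      exact hc j hj
    · obtain rfl : j = i := Fin.ext hj
      rw [hs ((hdet α hα).2 j), ← backtrans_orig_subst (α.tgt j) τ, ← ht]
      exact hr
  · rw [← ht, ← uApp_congr hα i _ fun x hx => (hτσ x hx).symm]
    exact hsteps

/-- A term `U^α_i(sᵢ, Xᵢ) σ` with normalized `σ`, for which the conditions before `i` hold, has a
sound normalization. -/
theorem soundNormalization_uApp (hterm : Terminating (Step (USeq R e)))
    (hdet : R.IsDeterministic) {α : CRule L V} (hα : α ∈ R)
    (d : ℕ) (i : Fin α.length) (hd : (i : ℕ) + d + 1 = α.length)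
    (σ : V → (USig R e).Term V) (hσ : ∀ x, IsNormalForm (Step (USeq R e)) (σ x))
    (hc : CondsHold R e α i σ)
    (ih : SoundBelow R e (uApp R e α hα i ((orig R e (α.src i)).subst σ) σ)) :
    SoundNormalization R e (uApp R e α hα i ((orig R e (α.src i)).subst σ) σ)
      (α.lhs.subst fun x => backtrans R e (σ x)) := by
  -- `d` is the number of conditions after the `i`-th, counted from 0.
  induction d generalizing i σ with
  | zero =>
    rcases soundNormalization_or_match hterm hdet hα i σ hσ hc ih with h | ⟨τ, hτ, hτσ, hcτ, hst⟩
    · exact h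
    have hlhs : (α.lhs.subst fun x => backtrans R e (σ x)) =
        α.lhs.subst fun x => backtrans R e (τ x) :=
      subst_congr fun x hx => by rw [hτσ x (Finset.mem_union_left _ hx)]
    have hstep := step_elimination hα i hd τ
    -- All conditions now hold for `τ`: rτ is a reduct of the starting term, and the backtranslated
    -- step from l to r is a conditional step.
    refine (ih α.rhs τ hτ ?_).of_steps (hst.tail hstep) ?_
    · exact .head' (.inl hstep) hst.below
    · rw [hlhs]
      exact .single (CTRS.rewrites_subst hα fun j => hcτ j (by have := j.2; omega))
  | succ d ihd =>
    rcases soundNormalization_or_match hterm hdet hα i σ hσ hc ih with h | ⟨τ, hτ, hτσ, hcτ, hst⟩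
    · exact h
    have hlhs : (α.lhs.subst fun x => backtrans R e (σ x)) =
        α.lhs.subst fun x => backtrans R e (τ x) :=
      subst_congr fun x hx => by rw [hτσ x (Finset.mem_union_left _ hx)]
    have hsteps := hst.tail (step_switch hα i (by omega) τ)
    rw [hlhs]
    exact (ihd ⟨i + 1, by omega⟩ (by simp only; omega) τ hτ hcτ (ih.of_steps hsteps)).of_steps
      hsteps .refl

/-- Left-hand sides with an original root symbol come from R. Not being variables, they have all
their variables strictly below the root, so the match sends these into normalized arguments. -/
theorem exists_match_lhs (hterm : Terminating (Step (USeq R e))) {n : ℕ} {f : L.Functions n}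
    {ts : Fin n → (USig R e).Term V} (hts : ∀ i, IsNormalForm (Step (USeq R e)) (ts i))
    {b : (USig R e).Term V} (hb : Step (USeq R e) (Term.func (L := USig R e) (Sum.inl f) ts) b) :
    ∃ α ∈ R, ∃ τ : V → (USig R e).Term V, (∀ x, IsNormalForm (Step (USeq R e)) (τ x)) ∧
      Term.func (L := USig R e) (Sum.inl f) ts = (orig R e α.lhs).subst τ := by
  obtain ⟨l, r, hlr, ρ, hl, -⟩ := Step.func_cases hts hb
  have key : ∀ {β : CRule L V}, β ∈ R →
      Term.func (L := USig R e) (Sum.inl f) ts = (orig R e β.lhs).subst ρ →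
      ∃ α ∈ R, ∃ τ : V → (USig R e).Term V, (∀ x, IsNormalForm (Step (USeq R e)) (τ x)) ∧
        Term.func (L := USig R e) (Sum.inl f) ts = (orig R e α.lhs).subst τ := by
    intro β hβ h
    obtain ⟨τ, hτ, hτρ⟩ := exists_normalized hterm β.lhs.varFinset ρ (by
      have hvar := lhs_ne_var hterm hβ
      cases hβl : β.lhs with
      | var x => exact absurd hβl (hvar x)
      | func g us =>
        rw [hβl, orig_func] at h
        cases h
        intro x hx
        obtain ⟨i, hi⟩ : ∃ i, x ∈ (us i).varFinset := by simpa [Term.varFinset] using hx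
        exact (hts i).of_subst (t := orig R e (us i)) (by rwa [varFinset_orig]))
    refine ⟨β, hβ, τ, hτ, h.trans (subst_congr fun x hx => (hτρ x ?_).symm)⟩
    rwa [varFinset_orig] at hx
  have no : ∀ {β : CRule L V} {hβ : β ∈ R} {j : Fin β.length} {s : (USig R e).Term V},
      Term.func (L := USig R e) (Sum.inl f) ts ≠ (uTerm R e β hβ j s).subst ρ := by
    intro β hβ j s h
    rw [uTerm_subst] at h
    have hroot := congrArg (uRoot R e) h
    rw [uRoot_uApp] at hroot
    cases hroot
  rcases hlr with ⟨β, hβ, _⟩ | ⟨β, hβ, _⟩ | ⟨β, hβ, j, _⟩ | ⟨β, hβ, j, _⟩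
  · exact key hβ hl
  · exact key hβ hl
  · exact absurd hl no
  · exact absurd hl no

/-- Normalized substitutions are needed for the induction: a match may bind variables to stuck
U-terms, which then occur in the instances of s_i and r. -/
theorem soundNormalization_orig_subst (hterm : Terminating (Step (USeq R e)))
    (hdet : R.IsDeterministic) (t : L.Term V) (σ : V → (USig R e).Term V)
    (hσ : ∀ x, IsNormalForm (Step (USeq R e)) (σ x)) :
    SoundNormalization R e ((orig R e t).subst σ) (t.subst fun x => backtrans R e (σ x)) := by
  generalize hu : (orig R e t).subst σ = u
  -- The transitive closure lets the hypothesis reach a subterm after several rewrite steps.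
  induction u using (Below.wellFounded hterm).transGen.induction generalizing t σ with
  | _ u ih =>
  subst hu
  replace ih : SoundBelow R e ((orig R e t).subst σ) := fun t' σ' hσ' h => ih _ h t' σ' hσ' rfl
  cases t with
  | var x => exact ⟨σ x, .refl, hσ x, .refl⟩
  | func f ts =>
    choose ns hns hnf hr using fun i =>
      ih (ts i) σ hσ (.single (.inr ⟨_, _, fun i => (orig R e (ts i)).subst σ, i, rfl, rfl⟩))
    have hsteps : Steps (USeq R e) ((orig R e (Term.func f ts)).subst σ)
        (Term.func (L := USig R e) (Sum.inl f) ns) := Steps.func _ hns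
    have hrew : Relation.ReflTransGen R.Rewrites
        ((Term.func f ts).subst fun x => backtrans R e (σ x))
        (backtrans R e (Term.func (L := USig R e) (Sum.inl f) ns)) := by
      rw [CTRS.rewrites_eq] at hr ⊢
      exact Steps.func f hr
    by_cases hw : IsNormalForm (Step (USeq R e)) (Term.func (L := USig R e) (Sum.inl f) ns)
    · exact ⟨_, hsteps, hw, hrew⟩
    unfold IsNormalForm at hw
    push Not at hw
    obtain ⟨b, hb⟩ := hw
    obtain ⟨α, hα, τ, hτ, heq⟩ := exists_match_lhs hterm hnf hb
    rw [heq] at hsteps hrew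
    rw [backtrans_orig_subst] at hrew
    refine SoundNormalization.of_steps ?_ hsteps hrew
    rcases Nat.eq_zero_or_pos α.length with h0 | h0
    · have hstep := step_unconditional (e := e) hα h0 τ
      refine (ih α.rhs τ hτ (.head' (.inl hstep) hsteps.below)).of_steps (.single hstep)
        (.single (CTRS.rewrites_subst hα fun j => ?_))
      exact absurd j.2 (by omega)
    · have hstep := step_introduction (e := e) hα h0 τ
      refine SoundNormalization.of_steps ?_ (.single hstep) .refl
      exact soundNormalization_uApp hterm hdet hα (α.length - 1) ⟨0, h0⟩ (by simp only; omega) τ hτ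
        (fun j hj => absurd hj (Nat.not_lt_zero _)) (ih.of_steps (hsteps.tail hstep))

/-- Confluence and termination of the sequential unraveling imply confluence of a deterministic
conditional system. Right-stability is not used: innermost normalization is sound without it. -/
theorem confluent_of_unraveling (hdet : R.IsDeterministic)
    (hconf : Confluent (Step (USeq R e))) (hterm : Terminating (Step (USeq R e))) :
    Confluent R.Rewrites := by
  intro u v w huv huw
  have key : ∀ v, SoundNormalization R e (orig R e v) v := fun v => by
    have := soundNormalization_orig_subst hterm hdet v FirstOrder.Language.Term.var
      (isNormalForm_var hterm)
    rw [subst_var] at this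
    simpa only [backtrans, subst_var] using this
  obtain ⟨m, hm, hmn, hvm⟩ := key v
  obtain ⟨n, hn, hnn, hwn⟩ := key w
  -- `m` and `n` are normal forms of the same term `orig R e u`, so both equal the common reduct
  -- `d`.
  obtain ⟨d, hmd, hnd⟩ := hconf _ m n ((steps_orig huv).trans hm) ((steps_orig huw).trans hn)
  obtain rfl := hmn.eq_of_steps hmd
  obtain rfl := hnn.eq_of_steps hnd
  exact ⟨_, hvm, hwn⟩

end Unraveling

end Rewriting

theorem mainTheorem1 {L : FirstOrder.Language} {V : Type*} [DecidableEq V] [Countable V]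
    [Infinite V] (e : Rewriting.VarSeq V) (R : Rewriting.CTRS L V)
    (hdet : R.IsDeterministic) (hrs : R.IsRightStable)
    (hconf : Rewriting.Confluent (Rewriting.Step (Rewriting.USeq R e)))
    (hterm : Rewriting.Terminating (Rewriting.Step (Rewriting.USeq R e))) :
    Rewriting.Confluent R.Rewrites :=
  Rewriting.confluent_of_unraveling hdet hconf hterm
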